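/- For $m\times n$ $(0,1)$-matrices $A$ and a positive integer $t$, let the $t$-term rank $\rho_t(A)$ be the largest number of $1$s of $A$ that can be chosen with at most $t$ chosen $1$s in each row and at most one chosen $1$ in each column. Let $R=(r_1,\dots,r_m)$ and $S=(s_1,\dots,s_n)$ be monotone nonincreasing vectors of nonnegative integers such that the class $\mathcal A(R,S)$ of all $m\times n$ $(0,1)$-matrices with row sum vector $R$ and column sum vector $S$ is nonempty, and let $t$ be a positive integer. For $0\le e\le m$ and $0\le f\le n$ put $$t_{ef}(R,S)=ef-\sum_{j=1}^{f}s_j+\sum_{i=e+1}^{m}r_i .$$ Then the maximum $t$-term rank $\overline{\rho_t}(R,S)=\max\{\rho_t(A):A\in\mathcal A(R,S)\}$ satisfies $$\overline{\rho_t}(R,S)=\min\{t_{ef}(R,S)+te+f:\ 0\le e\le m,\ 0\le f\le n\}.$$ -/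

import Mathlib

/-- `A` is a `(0,1)`-matrix. -/
def IsZeroOneMatrix {m n : ℕ} (A : Matrix (Fin m) (Fin n) ℕ) : Prop :=
  ∀ i j, A i j = 0 ∨ A i j = 1

/-- The class `𝒜(R,S)` of all `m × n` `(0,1)`-matrices with row sum vector `R` and column sum
vector `S`. -/
def matrixClass {m n : ℕ} (R : Fin m → ℕ) (S : Fin n → ℕ) : Set (Matrix (Fin m) (Fin n) ℕ) :=
  {A | IsZeroOneMatrix A ∧ (∀ i, ∑ j, A i j = R i) ∧ (∀ j, ∑ i, A i j = S j)}

/-- `P` is a set of positions of `1`s of `A`, with at most `t` of them in each row and at most one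
of them in each column. -/
def IsTTermSet {m n : ℕ} (t : ℕ) (A : Matrix (Fin m) (Fin n) ℕ)
    (P : Finset (Fin m × Fin n)) : Prop :=
  (∀ p ∈ P, A p.1 p.2 = 1) ∧
  (∀ i : Fin m, (P.filter (fun p => p.1 = i)).card ≤ t) ∧
  (∀ j : Fin n, (P.filter (fun p => p.2 = j)).card ≤ 1)

instance {m n : ℕ} (t : ℕ) (A : Matrix (Fin m) (Fin n) ℕ) :
    DecidablePred (IsTTermSet t A) := fun P => by
  unfold IsTTermSet; infer_instance

/-- The `t`-term rank of `A`: the largest number of `1`s of `A` with at most `t` of them in each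
row and at most one of them in each column. -/
def tTermRank {m n : ℕ} (t : ℕ) (A : Matrix (Fin m) (Fin n) ℕ) : ℕ :=
  ((Finset.univ : Finset (Finset (Fin m × Fin n))).filter (IsTTermSet t A)).sup Finset.card

/-- The maximum `t`-term rank over the class `𝒜(R,S)`. -/
noncomputable def maxTTermRank {m n : ℕ} (t : ℕ) (R : Fin m → ℕ) (S : Fin n → ℕ) : ℕ :=
  sSup (tTermRank t '' matrixClass R S)

/-- The structure matrix, with rows indexed by `0, …, m` and columns by `0, …, n`, and entries
`t_{kl} = k l - ∑_{j ≤ l} s_j + ∑_{i > k} r_i` (with `i`, `j` counted from `1`).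
Since `Fin` counts from `0`, the index `j` below stands for `j + 1`, so `j + 1 ≤ l` reads `j < l`
and `i + 1 > k` reads `k ≤ i`. -/
def structureMatrix {m n : ℕ} (R : Fin m → ℕ) (S : Fin n → ℕ) :
    Matrix (Fin (m + 1)) (Fin (n + 1)) ℤ := fun k l =>
  (k.val : ℤ) * (l.val : ℤ)
    - ∑ j ∈ Finset.univ.filter (fun j : Fin n => j.val < l.val), (S j : ℤ)
    + ∑ i ∈ Finset.univ.filter (fun i : Fin m => k.val ≤ i.val), (R i : ℤ)

/-!
The upper bound is a covering argument: a `t`-term set of `A` has at most `t e` members in the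
first `e` rows, at most `f` in the first `f` columns, and the others are `1`s of `A` in the
complementary block. For `A` in `𝒜(R,S)`, the number `t_{ef}` counts the `0`s of `A` in the leading
`e × f` block plus the `1`s in that complementary block (`structureMatrix_eq`, `tTermRank_le`).

For the matching construction, a `t`-term set of `A` is the same as a `(0,1)`-matrix `C ≤ A` whose
row sums are at least `r_i - t` and whose column sums are at least `s_j - 1`; its size is the number
of `1`s of `A - C`. The condition `C ≤ A` can be dropped at first: column sums of `A` and `C` differ
by `0` or `1`, and under this hypothesis interchanges inside the two classes turn any such pair into
one with `C ≤ A` (`exists_le_of_mem_matrixClass`). It remains to find a `(0,1)`-matrix `C` with row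
sums in `[r_i - t, r_i]` and column sums in `[s_j - 1, s_j]` having as few `1`s as possible.
If `C` is a minimal one, no alternating walk joins a row above its lower bound to a column above its
lower bound, since flipping along it would remove a `1` (`AltWalk.exists_shrink`). The rows from
which such a column can be reached give sets `E` of rows and `F` of columns, all at their lower
bounds, with `C` equal to `1` on `E × F` and `0` on the complementary block. Hence `C` has exactly
`∑_{E} (r_i - t)⁺ + ∑_{F} (s_j - 1)⁺ - |E| |F|` ones (`exists_tight_sets`). By monotonicity
of `R` and `S`, replacing `E` and `F` by initial segments only lowers the resulting value of
`t_{ef} + t e + f` (`exists_le_tTermRank`).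
-/

/-! ### Changing entries and interchanges -/

/-- The matrix `C` with its entry at `(i, j)` replaced by `v`. -/
def setEntry {m n : ℕ} (C : Matrix (Fin m) (Fin n) ℕ) (i : Fin m) (j : Fin n) (v : ℕ) :
    Matrix (Fin m) (Fin n) ℕ :=
  fun a b => if a = i ∧ b = j then v else C a b

lemma IsZeroOneMatrix.setEntry {m n : ℕ} {C : Matrix (Fin m) (Fin n) ℕ} (hC : IsZeroOneMatrix C)
    (i : Fin m) (j : Fin n) {v : ℕ} (hv : v = 0 ∨ v = 1) : IsZeroOneMatrix (setEntry C i j v) := by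
  intro a b
  unfold _root_.setEntry
  split_ifs
  exacts [hv, hC a b]

lemma rowSum_setEntry {m n : ℕ} (C : Matrix (Fin m) (Fin n) ℕ) (i : Fin m) (j : Fin n) (v : ℕ)
    (a : Fin m) :
    ∑ b, setEntry C i j v a b + (if a = i then C i j else 0)
      = ∑ b, C a b + (if a = i then v else 0) := by
  by_cases h : a = i
  · subst h
    rw [← Finset.add_sum_erase _ _ (Finset.mem_univ j),
      ← Finset.add_sum_erase (a := j) _ (fun b => C a b) (Finset.mem_univ j),
      Finset.sum_congr rfl (g := fun b => C a b)]
    · simp [setEntry]; ring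
    · intro b hb
      simp [setEntry, Finset.ne_of_mem_erase hb]
  · simp [setEntry, h]

lemma colSum_setEntry {m n : ℕ} (C : Matrix (Fin m) (Fin n) ℕ) (i : Fin m) (j : Fin n) (v : ℕ)
    (b : Fin n) :
    ∑ a, setEntry C i j v a b + (if b = j then C i j else 0)
      = ∑ a, C a b + (if b = j then v else 0) := by
  by_cases h : b = j
  · subst h
    rw [← Finset.add_sum_erase _ _ (Finset.mem_univ i),
      ← Finset.add_sum_erase (a := i) _ (fun a => C a b) (Finset.mem_univ i),
      Finset.sum_congr rfl (g := fun a => C a b)]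
    · simp [setEntry]; ring
    · intro a ha
      simp [setEntry, Finset.ne_of_mem_erase ha]
  · simp [setEntry, h]

/-- Effect of one changed entry on an arbitrary entrywise weight, stated without subtraction. -/
lemma sum_setEntry {m n : ℕ} (g : Fin m → Fin n → ℕ → ℕ) (C : Matrix (Fin m) (Fin n) ℕ)
    (i : Fin m) (j : Fin n) (v : ℕ) :
    ∑ p : Fin m × Fin n, g p.1 p.2 (setEntry C i j v p.1 p.2) + g i j (C i j)
      = ∑ p : Fin m × Fin n, g p.1 p.2 (C p.1 p.2) + g i j v := by
  rw [← Finset.add_sum_erase _ _ (Finset.mem_univ (i, j)),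
    ← Finset.add_sum_erase (a := (i, j)) _ (fun p : Fin m × Fin n => g p.1 p.2 (C p.1 p.2))
      (Finset.mem_univ (i, j)),
    Finset.sum_congr rfl (g := fun p : Fin m × Fin n => g p.1 p.2 (C p.1 p.2))]
  · simp [setEntry]; ring
  · rintro ⟨a, b⟩ hp
    have := Finset.ne_of_mem_erase hp
    simp only [ne_eq, Prod.mk.injEq] at this
    simp [setEntry, this]

/-- `M` with its `2 × 2` submatrix on rows `i`, `k` and columns `j`, `l` replaced by the identity
matrix. Applied where that submatrix is the anti-identity, this is Ryser's interchange. -/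
def interchange {m n : ℕ} (M : Matrix (Fin m) (Fin n) ℕ) (i k : Fin m) (j l : Fin n) :
    Matrix (Fin m) (Fin n) ℕ :=
  setEntry (setEntry (setEntry (setEntry M i j 1) i l 0) k j 0) k l 1

lemma interchange_mem {m n : ℕ} {R : Fin m → ℕ} {S : Fin n → ℕ} {M : Matrix (Fin m) (Fin n) ℕ}
    (hM : M ∈ matrixClass R S) {i k : Fin m} {j l : Fin n} (hik : i ≠ k) (hjl : j ≠ l)
    (hij : M i j = 0) (hil : M i l = 1) (hkj : M k j = 1) (hkl : M k l = 0) :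
    interchange M i k j l ∈ matrixClass R S := by
  have e2 : setEntry M i j 1 i l = 1 := by simp [setEntry, hil]
  have e3 : setEntry (setEntry M i j 1) i l 0 k j = 1 := by simp [setEntry, hkj, hik.symm]
  have e4 : setEntry (setEntry (setEntry M i j 1) i l 0) k j 0 k l = 0 := by
    simp [setEntry, hkl, hik.symm, hjl.symm]
  refine ⟨(((hM.1.setEntry i j (.inr rfl)).setEntry i l (.inl rfl)).setEntry k j
    (.inl rfl)).setEntry k l (.inr rfl), fun a => ?_, fun b => ?_⟩
  · have h1 := rowSum_setEntry M i j 1 a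
    have h2 := rowSum_setEntry (setEntry M i j 1) i l 0 a
    have h3 := rowSum_setEntry (setEntry (setEntry M i j 1) i l 0) k j 0 a
    have h4 := rowSum_setEntry (setEntry (setEntry (setEntry M i j 1) i l 0) k j 0) k l 1 a
    rw [hM.2.1 a, hij] at h1
    rw [e2] at h2
    rw [e3] at h3
    rw [e4] at h4
    unfold interchange
    split_ifs at * <;> omega
  · have h1 := colSum_setEntry M i j 1 b
    have h2 := colSum_setEntry (setEntry M i j 1) i l 0 b
    have h3 := colSum_setEntry (setEntry (setEntry M i j 1) i l 0) k j 0 b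
    have h4 := colSum_setEntry (setEntry (setEntry (setEntry M i j 1) i l 0) k j 0) k l 1 b
    rw [hM.2.2 b, hij] at h1
    rw [e2] at h2
    rw [e3] at h3
    rw [e4] at h4
    unfold interchange
    split_ifs at * <;> omega

lemma sum_interchange {m n : ℕ} (g : Fin m → Fin n → ℕ → ℕ) {M : Matrix (Fin m) (Fin n) ℕ}
    {i k : Fin m} {j l : Fin n} (hik : i ≠ k) (hjl : j ≠ l)
    (hij : M i j = 0) (hil : M i l = 1) (hkj : M k j = 1) (hkl : M k l = 0) :
    ∑ p : Fin m × Fin n, g p.1 p.2 (interchange M i k j l p.1 p.2)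
        + (g i j 0 + g i l 1 + g k j 1 + g k l 0)
      = ∑ p : Fin m × Fin n, g p.1 p.2 (M p.1 p.2)
        + (g i j 1 + g i l 0 + g k j 0 + g k l 1) := by
  have e2 : setEntry M i j 1 i l = 1 := by simp [setEntry, hil]
  have e3 : setEntry (setEntry M i j 1) i l 0 k j = 1 := by simp [setEntry, hkj, hik.symm]
  have e4 : setEntry (setEntry (setEntry M i j 1) i l 0) k j 0 k l = 0 := by
    simp [setEntry, hkl, hik.symm, hjl.symm]
  have h1 := sum_setEntry g M i j 1
  have h2 := sum_setEntry g (setEntry M i j 1) i l 0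
  have h3 := sum_setEntry g (setEntry (setEntry M i j 1) i l 0) k j 0
  have h4 := sum_setEntry g (setEntry (setEntry (setEntry M i j 1) i l 0) k j 0) k l 1
  rw [hij] at h1
  rw [e2] at h2
  rw [e3] at h3
  rw [e4] at h4
  unfold interchange
  omega

/-! ### Making one matrix dominate another -/

/-- If the row sums of `C` are at most those of `A`, and the column sums of `A` exceed those of `C`
by `0` or `1`, then `A` and `C` can be replaced within their classes so that `C ≤ A`. A pair
violating `C ≤ A` admits an interchange in `A` or in `C` that lowers the number of positions with
`C = 1`, `A = 0`. -/
theorem exists_le_of_mem_matrixClass {m n : ℕ} {R R' : Fin m → ℕ} {S S' : Fin n → ℕ}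
    (hR : ∀ i, R' i ≤ R i) (hS : ∀ j, S' j ≤ S j) (hS' : ∀ j, S j ≤ S' j + 1)
    {A C : Matrix (Fin m) (Fin n) ℕ} (hA : A ∈ matrixClass R S) (hC : C ∈ matrixClass R' S') :
    ∃ A ∈ matrixClass R S, ∃ C ∈ matrixClass R' S', ∀ i j, C i j ≤ A i j := by
  induction hd : ∑ p : Fin m × Fin n, (C p.1 p.2 - A p.1 p.2) using Nat.strong_induction_on
    generalizing A C with
  | _ d ih =>
  by_cases hle : ∀ i j, C i j ≤ A i j
  · exact ⟨A, hA, C, hC, hle⟩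
  push Not at hle
  obtain ⟨i, j, hij⟩ := hle
  have hCij : C i j = 1 := by have := hC.1 i j; omega
  have hAij : A i j = 0 := by omega
  obtain ⟨l, hl⟩ : ∃ l, C i l < A i l := by
    by_contra! h
    have h1 := Finset.sum_lt_sum (fun b _ => h b) ⟨j, Finset.mem_univ j, hij⟩
    rw [hA.2.1, hC.2.1] at h1
    exact absurd (hR i) (by omega)
  have hAil : A i l = 1 := by have := hA.1 i l; omega
  have hCil : C i l = 0 := by omega
  have hjl : j ≠ l := by rintro rfl; omega
  -- Outside row `i`, column `j` of `A - C` has sum at least `1` and column `l` at most `0`,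
  -- so some row `k` has a larger entry of `A - C` in column `j` than in column `l`.
  obtain ⟨k, hik, hk⟩ : ∃ k, i ≠ k ∧ A k l + C k j < A k j + C k l := by
    by_contra! h
    have h1 : ∑ k, (A k j + C k l + (if i = k then 2 else 0)) ≤ ∑ k, (A k l + C k j) := by
      refine Finset.sum_le_sum fun k _ => ?_
      by_cases hik : i = k
      · subst hik; simp [*]
      · simpa [hik] using h k hik
    simp only [Finset.sum_add_distrib, hA.2.2, hC.2.2, Finset.sum_ite_eq, Finset.mem_univ,
      if_true] at h1
    have := hS j
    have := hS' l
    omega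
  have a1 := hA.1 k j
  have a2 := hA.1 k l
  have c1 := hC.1 k j
  have c2 := hC.1 k l
  -- Whichever of `A`, `C` causes that inequality admits an interchange. It raises `A - C` at
  -- `(i, j)` and `(k, l)` and lowers it at `(i, l)` and `(k, j)`; if `(k, j)` becomes `-1`,
  -- then `(k, l)` was `-1` before.
  by_cases hAk : A k j = 1 ∧ A k l = 0
  · have hs := sum_interchange (fun a b x => C a b - x) hik hjl hAij hAil hAk.1 hAk.2
    refine ih _ ?_ (interchange_mem hA hik hjl hAij hAil hAk.1 hAk.2) hC rfl
    rw [← hd]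
    beta_reduce at hs
    omega
  · have hCk : C k j = 0 ∧ C k l = 1 := by omega
    have hs := sum_interchange (fun a b x => x - A a b) hik.symm hjl hCk.1 hCk.2 hCij hCil
    refine ih _ ?_ hA (interchange_mem hC hik.symm hjl hCk.1 hCk.2 hCij hCil) rfl
    rw [← hd]
    beta_reduce at hs
    omega

/-! ### Alternating walks and minimal matrices -/

/-- There is an alternating walk from row `i` to a column in `L` that visits `ℓ` further rows:
it leaves a row at a `1` of `C` and a column at a `0` of `C`. -/
def AltWalk {m n : ℕ} (L : Set (Fin n)) (C : Matrix (Fin m) (Fin n) ℕ) : ℕ → Fin m → Prop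
  | 0, i => ∃ j ∈ L, C i j = 1
  | ℓ + 1, i => ∃ j k, C i j = 1 ∧ C k j = 0 ∧ AltWalk L C ℓ k

/-- Flipping the entries of `C` along a shortest alternating walk from row `i` to `L` lowers by one
the sum of row `i` and of one column in `L`, and keeps all other row and column sums. -/
lemma AltWalk.exists_shrink {m n : ℕ} {L : Set (Fin n)} {ℓ : ℕ} {C : Matrix (Fin m) (Fin n) ℕ}
    {i : Fin m} (hC : IsZeroOneMatrix C) (h : AltWalk L C ℓ i) :
    ∃ C', IsZeroOneMatrix C' ∧ ∃ j ∈ L,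
      (∀ a, ∑ b, C' a b + (if a = i then 1 else 0) = ∑ b, C a b) ∧
      (∀ b, ∑ a, C' a b + (if b = j then 1 else 0) = ∑ a, C a b) := by
  induction ℓ using Nat.strong_induction_on generalizing C i with
  | _ ℓ ih =>
  by_cases hmin : ∃ ℓ' < ℓ, AltWalk L C ℓ' i
  · obtain ⟨ℓ', hlt, h'⟩ := hmin
    exact ih ℓ' hlt hC h'
  push Not at hmin
  cases ℓ with
  | zero =>
    obtain ⟨j, hj, hij⟩ := h
    refine ⟨setEntry C i j 0, hC.setEntry i j (.inl rfl), j, hj, fun a => ?_, fun b => ?_⟩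
    · simpa [hij] using rowSum_setEntry C i j 0 a
    · simpa [hij] using colSum_setEntry C i j 0 b
  | succ ℓ =>
    obtain ⟨j, k, hij, hkj, hk⟩ := h
    have hik : k ≠ i := by rintro rfl; omega
    have e : setEntry C i j 0 k j = 0 := by simp [setEntry, hkj]
    -- The rest of a shortest walk avoids column `j`, so it survives the change there.
    have key : ∀ ℓ' ≤ ℓ, ∀ a, AltWalk L C ℓ' a →
        AltWalk L (setEntry (setEntry C i j 0) k j 1) ℓ' a := by
      intro ℓ'
      induction ℓ' with
      | zero =>
        rintro - a ⟨b, hb, hab⟩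
        have hbj : b ≠ j := by
          rintro rfl
          exact hmin 0 (by omega) ⟨b, hb, hij⟩
        exact ⟨b, hb, by simp [setEntry, hbj, hab]⟩
      | succ ℓ' ih' =>
        rintro hℓ a ⟨b, c, hab, hcb, hc⟩
        have hbj : b ≠ j := by
          rintro rfl
          exact hmin (ℓ' + 1) (by omega) ⟨b, c, hij, hcb, hc⟩
        exact ⟨b, c, by simp [setEntry, hbj, hab], by simp [setEntry, hbj, hcb],
          ih' (by omega) c hc⟩
    obtain ⟨C', hC', l, hl, hrow, hcol⟩ :=
      ih ℓ (by omega) ((hC.setEntry i j (.inl rfl)).setEntry k j (.inr rfl)) (key ℓ le_rfl k hk)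
    refine ⟨C', hC', l, hl, fun a => ?_, fun b => ?_⟩
    · have h1 := rowSum_setEntry C i j 0 a
      have h2 := rowSum_setEntry (setEntry C i j 0) k j 1 a
      rw [hij] at h1
      rw [e] at h2
      have h3 := hrow a
      split_ifs at * <;> omega
    · have h1 := colSum_setEntry C i j 0 b
      have h2 := colSum_setEntry (setEntry C i j 0) k j 1 b
      rw [hij] at h1
      rw [e] at h2
      have h3 := hcol b
      split_ifs at * <;> omega

/-- Min-max duality for the number of `1`s of a `(0,1)`-matrix with row sums at least `a` and column
sums at least `b`, in the presence of a matrix with larger margins `R`, `S`. The upper bounds `R`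
and `S` do not enter the value, since flipping an alternating walk never raises a row or column
sum. -/
theorem exists_tight_sets {m n : ℕ} {R a : Fin m → ℕ} {S b : Fin n → ℕ}
    (haR : ∀ i, a i ≤ R i) (hbS : ∀ j, b j ≤ S j) (hne : (matrixClass R S).Nonempty) :
    ∃ C, IsZeroOneMatrix C ∧
      (∀ i, a i ≤ ∑ j, C i j ∧ ∑ j, C i j ≤ R i) ∧
      (∀ j, b j ≤ ∑ i, C i j ∧ ∑ i, C i j ≤ S j) ∧
      ∃ (E : Finset (Fin m)) (F : Finset (Fin n)),
        ∑ i, ∑ j, C i j + E.card * F.card = ∑ i ∈ E, a i + ∑ j ∈ F, b j := by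
  classical
  let Feas : Matrix (Fin m) (Fin n) ℕ → Prop := fun C => IsZeroOneMatrix C ∧
      (∀ i, a i ≤ ∑ j, C i j ∧ ∑ j, C i j ≤ R i) ∧
      (∀ j, b j ≤ ∑ i, C i j ∧ ∑ i, C i j ≤ S j)
  have hex : ∃ N C, Feas C ∧ ∑ i, ∑ j, C i j = N := by
    obtain ⟨A, hA⟩ := hne
    exact ⟨_, A, ⟨hA.1, fun i => by simp [hA.2.1, haR], fun j => by simp [hA.2.2, hbS]⟩, rfl⟩
  obtain ⟨C, hC, hN⟩ := Nat.find_spec hex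
  have hmin : ∀ C', Feas C' → ∑ i, ∑ j, C i j ≤ ∑ i, ∑ j, C' i j := fun C' hC' =>
    hN ▸ Nat.find_min' hex ⟨C', hC', rfl⟩
  refine ⟨C, hC.1, hC.2.1, hC.2.2, ?_⟩
  -- The columns above their lower bound, and the rows from which one of them can be reached.
  let L : Set (Fin n) := {j | b j < ∑ i, C i j}
  let E : Finset (Fin m) := Finset.univ.filter fun i => ∃ ℓ, AltWalk L C ℓ i
  let F : Finset (Fin n) := Finset.univ.filter fun j => j ∉ L ∧ ∀ k ∈ E, C k j = 1
  have hE : ∀ i ∈ E, ∑ j, C i j = a i := by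
    intro i hi
    obtain ⟨ℓ, hℓ⟩ := (Finset.mem_filter.1 hi).2
    by_contra hne
    obtain ⟨C', hC', j, hj, hrow, hcol⟩ := hℓ.exists_shrink hC.1
    have hlt : ∑ i, ∑ j, C' i j < ∑ i, ∑ j, C i j := by
      refine Finset.sum_lt_sum (fun r _ => ?_) ⟨i, Finset.mem_univ i, ?_⟩
      · have := hrow r; omega
      · have := hrow i; simp only [if_true] at this; omega
    refine absurd (hmin C' ⟨hC', fun r => ?_, fun c => ?_⟩) (by omega)
    · have h1 := hrow r
      have h2 := hC.2.1 r
      by_cases hr : r = i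
      · subst hr; simp only [if_true] at h1; omega
      · simp only [hr, if_false] at h1; omega
    · have h1 := hcol c
      have h2 := hC.2.2 c
      by_cases hc : c = j
      · subst hc
        simp only [if_true] at h1
        have h3 : b c < ∑ i, C i c := hj
        omega
      · simp only [hc, if_false] at h1; omega
  have hF : ∀ j ∈ F, ∑ i, C i j = b j := by
    intro j hj
    have h1 : ¬ b j < ∑ i, C i j := (Finset.mem_filter.1 hj).2.1
    have := (hC.2.2 j).1
    omega
  have hone : ∀ i ∈ E, ∀ j ∈ F, C i j = 1 := fun i hi j hj => (Finset.mem_filter.1 hj).2.2 i hi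
  have hzero : ∀ i ∉ E, ∀ j ∉ F, C i j = 0 := by
    intro i hi j hj
    by_contra h0
    have h1 : C i j = 1 := (hC.1 i j).resolve_left h0
    refine hi (Finset.mem_filter.2 ⟨Finset.mem_univ i, ?_⟩)
    by_cases hjL : j ∈ L
    · exact ⟨0, j, hjL, h1⟩
    have : ∃ k ∈ E, C k j ≠ 1 := by
      by_contra! h
      exact hj (Finset.mem_filter.2 ⟨Finset.mem_univ j, hjL, h⟩)
    obtain ⟨k, hk, hkj⟩ := this
    obtain ⟨ℓ, hℓ⟩ := (Finset.mem_filter.1 hk).2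
    exact ⟨ℓ + 1, j, k, h1, (hC.1 k j).resolve_right hkj, hℓ⟩
  refine ⟨E, F, ?_⟩
  rw [← Finset.sum_congr rfl hE, ← Finset.sum_congr rfl hF, ← Finset.sum_add_sum_compl E,
    add_assoc]
  congr 1
  rw [Finset.sum_comm (s := F), ← Finset.sum_add_sum_compl E, add_comm]
  congr 1
  · rw [Finset.sum_congr rfl fun i hi => Finset.sum_congr rfl (hone i hi)]
    simp
  · refine Finset.sum_congr rfl fun i hi => ?_
    rw [← Finset.sum_add_sum_compl F,
      Finset.sum_eq_zero (s := Fᶜ) fun j hj =>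
        hzero i (Finset.mem_compl.1 hi) j (Finset.mem_compl.1 hj), add_zero]

/-! ### From `(0,1)`-matrices to `t`-term ranks -/

theorem sum_le_sum_initial {n : ℕ} {S : Fin n → ℕ} (hS : Antitone S) (F : Finset (Fin n)) :
    ∑ j ∈ F, S j ≤ ∑ j ∈ Finset.univ.filter (fun j : Fin n => j.val < F.card), S j := by
  classical
  set I := Finset.univ.filter (fun j : Fin n => j.val < F.card) with hI
  have hcard : I.card = F.card := by
    have : F.card ≤ n := by simpa using Finset.card_le_univ F
    rw [hI, Fin.card_filter_val_lt]
    omega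
  have hsd : (F \ I).card = (I \ F).card := by
    have h1 := Finset.card_sdiff_add_card_inter F I
    have h2 := Finset.card_sdiff_add_card_inter I F
    rw [Finset.inter_comm] at h2
    omega
  rw [← Finset.sum_inter_add_sum_sdiff F I, ← Finset.sum_inter_add_sum_sdiff I F,
    Finset.inter_comm I F]
  refine Nat.add_le_add_left ?_ _
  rcases (F \ I).eq_empty_or_nonempty with h0 | ⟨x, hx⟩
  · simp [h0]
  -- Every value on `F \ I` is at most, and every value on `I \ F` at least, the value at `card F`.
  have hxI : F.card ≤ x.val := by simpa [hI] using (Finset.mem_sdiff.1 hx).2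
  let p : Fin n := ⟨F.card, by omega⟩
  calc ∑ j ∈ F \ I, S j ≤ (F \ I).card • S p := Finset.sum_le_card_nsmul _ _ _ fun j hj => hS (by
          have : F.card ≤ j.val := by simpa [hI] using (Finset.mem_sdiff.1 hj).2
          exact this)
    _ = (I \ F).card • S p := by rw [hsd]
    _ ≤ ∑ j ∈ I \ F, S j := Finset.card_nsmul_le_sum _ _ _ fun j hj => hS (by
          have : j.val < F.card := by simpa [hI] using (Finset.mem_sdiff.1 hj).1
          exact this.le)

lemma card_le_tTermRank {m n t : ℕ} {A : Matrix (Fin m) (Fin n) ℕ} {P : Finset (Fin m × Fin n)}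
    (hP : IsTTermSet t A P) : P.card ≤ tTermRank t A :=
  Finset.le_sup (f := Finset.card) (by simpa using hP)

/-- The positions where `C < A` form a `t`-term set of `A`. -/
lemma sum_le_sum_add_tTermRank {m n t : ℕ} {A C : Matrix (Fin m) (Fin n) ℕ} (hA : IsZeroOneMatrix A)
    (hC : IsZeroOneMatrix C) (hle : ∀ i j, C i j ≤ A i j)
    (hrow : ∀ i, ∑ j, A i j ≤ ∑ j, C i j + t) (hcol : ∀ j, ∑ i, A i j ≤ ∑ i, C i j + 1) :
    ∑ i, ∑ j, A i j ≤ ∑ i, ∑ j, C i j + tTermRank t A := by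
  classical
  let P : Finset (Fin m × Fin n) := Finset.univ.filter fun p => C p.1 p.2 < A p.1 p.2
  have hval : ∀ i j, A i j = C i j + if C i j < A i j then 1 else 0 := by
    intro i j
    have := hA i j
    have := hC i j
    have := hle i j
    split_ifs <;> omega
  have hPi : ∀ i, ∑ j, A i j = ∑ j, C i j + (P.filter fun p => p.1 = i).card := by
    intro i
    have : (P.filter fun p => p.1 = i).card = ∑ j, if C i j < A i j then 1 else 0 := by
      rw [Finset.card_filter, Finset.sum_filter, Fintype.sum_prod_type, Finset.sum_comm]
      refine Finset.sum_congr rfl fun j _ => ?_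
      rw [Finset.sum_eq_single i (fun a _ ha => by simp [ha]) (by simp)]
      simp
    rw [this, ← Finset.sum_add_distrib]
    exact Finset.sum_congr rfl fun j _ => hval i j
  have hPj : ∀ j, ∑ i, A i j = ∑ i, C i j + (P.filter fun p => p.2 = j).card := by
    intro j
    have : (P.filter fun p => p.2 = j).card = ∑ i, if C i j < A i j then 1 else 0 := by
      rw [Finset.card_filter, Finset.sum_filter, Fintype.sum_prod_type]
      refine Finset.sum_congr rfl fun i _ => ?_
      rw [Finset.sum_eq_single j (fun b _ hb => by simp [hb]) (by simp)]
      simp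
    rw [this, ← Finset.sum_add_distrib]
    exact Finset.sum_congr rfl fun i _ => hval i j
  have hPcard : ∑ i, ∑ j, A i j = ∑ i, ∑ j, C i j + P.card := by
    rw [Finset.sum_congr rfl fun i _ => hPi i, Finset.sum_add_distrib,
      ← Finset.card_eq_sum_card_fiberwise fun p _ => Finset.mem_univ _]
  rw [hPcard]
  refine Nat.add_le_add_left (card_le_tTermRank ⟨fun p hp => ?_, fun i => ?_, fun j => ?_⟩) _
  · have h1 : C p.1 p.2 < A p.1 p.2 := (Finset.mem_filter.1 hp).2
    have := hA p.1 p.2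
    omega
  · have := hPi i
    have := hrow i
    omega
  · have := hPj j
    have := hcol j
    omega

/-! ### The covering bound -/

/-- For every `A` in the class, `t_{ef}` is the number of `0`s of `A` in the leading `e × f` block
plus the number of `1`s in the complementary `(m - e) × (n - f)` block. -/
lemma structureMatrix_eq {m n : ℕ} {R : Fin m → ℕ} {S : Fin n → ℕ}
    {A : Matrix (Fin m) (Fin n) ℕ} (hA : A ∈ matrixClass R S) (e : Fin (m + 1)) (f : Fin (n + 1)) :
    structureMatrix R S e f
      = ∑ i ∈ Finset.univ.filter (fun i : Fin m => i.val < e.val),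
          ∑ j ∈ Finset.univ.filter (fun j : Fin n => j.val < f.val), (1 - (A i j : ℤ))
        + ∑ i ∈ Finset.univ.filter (fun i : Fin m => e.val ≤ i.val),
          ∑ j ∈ Finset.univ.filter (fun j : Fin n => f.val ≤ j.val), (A i j : ℤ) := by
  have hR : ∀ i, (R i : ℤ) = ∑ j, (A i j : ℤ) := fun i => by rw [← hA.2.1 i]; push_cast; rfl
  have hS : ∀ j, (S j : ℤ) = ∑ i, (A i j : ℤ) := fun j => by rw [← hA.2.2 j]; push_cast; rfl
  have he : (Finset.univ.filter (fun i : Fin m => i.val < e.val)).card = e.val := by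
    rw [Fin.card_filter_val_lt]; omega
  have hf : (Finset.univ.filter (fun j : Fin n => j.val < f.val)).card = f.val := by
    rw [Fin.card_filter_val_lt]; omega
  have h1 : ∑ j ∈ Finset.univ.filter (fun j : Fin n => j.val < f.val), (S j : ℤ)
      = ∑ i ∈ Finset.univ.filter (fun i : Fin m => i.val < e.val),
          ∑ j ∈ Finset.univ.filter (fun j : Fin n => j.val < f.val), (A i j : ℤ)
        + ∑ i ∈ Finset.univ.filter (fun i : Fin m => e.val ≤ i.val),
          ∑ j ∈ Finset.univ.filter (fun j : Fin n => j.val < f.val), (A i j : ℤ) := by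
    rw [Finset.sum_congr rfl fun j _ => hS j, Finset.sum_comm,
      ← Finset.sum_filter_add_sum_filter_not Finset.univ (fun i : Fin m => i.val < e.val)]
    simp only [not_lt]
  have h2 : ∑ i ∈ Finset.univ.filter (fun i : Fin m => e.val ≤ i.val), (R i : ℤ)
      = ∑ i ∈ Finset.univ.filter (fun i : Fin m => e.val ≤ i.val),
          ∑ j ∈ Finset.univ.filter (fun j : Fin n => j.val < f.val), (A i j : ℤ)
        + ∑ i ∈ Finset.univ.filter (fun i : Fin m => e.val ≤ i.val),
          ∑ j ∈ Finset.univ.filter (fun j : Fin n => f.val ≤ j.val), (A i j : ℤ) := by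
    rw [← Finset.sum_add_distrib]
    refine Finset.sum_congr rfl fun i _ => ?_
    rw [hR i, ← Finset.sum_filter_add_sum_filter_not Finset.univ (fun j : Fin n => j.val < f.val)]
    simp only [not_lt]
  unfold structureMatrix
  rw [h1, h2]
  simp only [Finset.sum_sub_distrib, Finset.sum_const, he, hf, nsmul_eq_mul, mul_one]
  ring

theorem tTermRank_le {m n t : ℕ} {R : Fin m → ℕ} {S : Fin n → ℕ}
    {A : Matrix (Fin m) (Fin n) ℕ} (hA : A ∈ matrixClass R S) (e : Fin (m + 1)) (f : Fin (n + 1)) :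
    (tTermRank t A : ℤ) ≤ structureMatrix R S e f + (t : ℤ) * (e.val : ℤ) + (f.val : ℤ) := by
  classical
  have hbound : tTermRank t A ≤
      ∑ i ∈ Finset.univ.filter (fun i : Fin m => e.val ≤ i.val),
        ∑ j ∈ Finset.univ.filter (fun j : Fin n => f.val ≤ j.val), A i j
      + t * e.val + f.val := by
    refine Finset.sup_le fun P hP => ?_
    obtain ⟨hone, hrow, hcol⟩ := (Finset.mem_filter.1 hP).2
    have he : (P.filter fun p => p.1.val < e.val).card ≤ t * e.val := by
      have := Finset.card_le_mul_card_image_of_maps_to (f := Prod.fst)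
        (s := P.filter fun p => p.1.val < e.val)
        (t := Finset.univ.filter (fun i : Fin m => i.val < e.val))
        (fun p hp => by simpa using (Finset.mem_filter.1 hp).2) t
        (fun i _ => (Finset.card_le_card fun p hp => by
          simp only [Finset.mem_filter] at hp ⊢; exact ⟨hp.1.1, hp.2⟩).trans (hrow i))
      rwa [Fin.card_filter_val_lt, min_eq_right (by omega)] at this
    have hf : (P.filter fun p => p.2.val < f.val).card ≤ f.val := by
      have := Finset.card_le_mul_card_image_of_maps_to (f := Prod.snd)
        (s := P.filter fun p => p.2.val < f.val)
        (t := Finset.univ.filter (fun j : Fin n => j.val < f.val))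
        (fun p hp => by simpa using (Finset.mem_filter.1 hp).2) 1
        (fun j _ => (Finset.card_le_card fun p hp => by
          simp only [Finset.mem_filter] at hp ⊢; exact ⟨hp.1.1, hp.2⟩).trans (hcol j))
      rwa [Fin.card_filter_val_lt, min_eq_right (by omega), one_mul] at this
    have hr : (P.filter fun p => e.val ≤ p.1.val ∧ f.val ≤ p.2.val).card ≤
        ∑ i ∈ Finset.univ.filter (fun i : Fin m => e.val ≤ i.val),
          ∑ j ∈ Finset.univ.filter (fun j : Fin n => f.val ≤ j.val), A i j := by
      rw [← Finset.sum_product _ _ fun p : Fin m × Fin n => A p.1 p.2, Finset.card_eq_sum_ones]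
      calc _ = ∑ p ∈ P.filter (fun p => e.val ≤ p.1.val ∧ f.val ≤ p.2.val), A p.1 p.2 :=
            Finset.sum_congr rfl fun p hp => (hone p (Finset.mem_filter.1 hp).1).symm
        _ ≤ _ := Finset.sum_le_sum_of_subset fun p hp => by
            simpa using (Finset.mem_filter.1 hp).2
    have hcover : P ⊆ ((P.filter fun p => e.val ≤ p.1.val ∧ f.val ≤ p.2.val) ∪
        (P.filter fun p => p.1.val < e.val)) ∪ (P.filter fun p => p.2.val < f.val) := by
      intro p hp
      simp only [Finset.mem_union, Finset.mem_filter, hp, true_and]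
      omega
    have h1 := Finset.card_le_card hcover
    have h2 := Finset.card_union_le ((P.filter fun p => e.val ≤ p.1.val ∧ f.val ≤ p.2.val) ∪
        (P.filter fun p => p.1.val < e.val)) (P.filter fun p => p.2.val < f.val)
    have h3 := Finset.card_union_le (P.filter fun p => e.val ≤ p.1.val ∧ f.val ≤ p.2.val)
        (P.filter fun p => p.1.val < e.val)
    omega
  have hnn : 0 ≤ ∑ i ∈ Finset.univ.filter (fun i : Fin m => i.val < e.val),
      ∑ j ∈ Finset.univ.filter (fun j : Fin n => j.val < f.val), (1 - (A i j : ℤ)) :=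
    Finset.sum_nonneg fun i _ => Finset.sum_nonneg fun j _ => by
      have := hA.1 i j
      omega
  rw [structureMatrix_eq hA]
  have hbound' := Int.ofNat_le.2 hbound
  push_cast at hbound'
  linarith

/-! ### Attaining the bound -/

/-- Some matrix in the class has a `t`-term set at least as large as one of the covering bounds. -/
theorem exists_le_tTermRank {m n : ℕ} (t : ℕ) {R : Fin m → ℕ} {S : Fin n → ℕ} (hR : Antitone R)
    (hS : Antitone S) (hne : (matrixClass R S).Nonempty) :
    ∃ A ∈ matrixClass R S, ∃ (e : Fin (m + 1)) (f : Fin (n + 1)),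
      structureMatrix R S e f + (t : ℤ) * (e.val : ℤ) + (f.val : ℤ) ≤ tTermRank t A := by
  classical
  obtain ⟨C₀, hC₀, hrow, hcol, E, F, hEF⟩ := exists_tight_sets (a := fun i => R i - t)
    (b := fun j => S j - 1) (fun i => Nat.sub_le _ _) (fun j => Nat.sub_le _ _) hne
  obtain ⟨A₀, hA₀⟩ := hne
  obtain ⟨A, hA, C, hC, hle⟩ := exists_le_of_mem_matrixClass (fun i => (hrow i).2)
    (fun j => (hcol j).2) (fun j => by have := (hcol j).1; omega) hA₀
    (C := C₀) ⟨hC₀, fun _ => rfl, fun _ => rfl⟩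
  have hrank := sum_le_sum_add_tTermRank (t := t) hA.1 hC.1 hle
    (fun i => by rw [hA.2.1, hC.2.1]; exact Nat.sub_le_iff_le_add.1 (hrow i).1)
    (fun j => by rw [hA.2.2, hC.2.2]; exact Nat.sub_le_iff_le_add.1 (hcol j).1)
  simp only [hA.2.1, hC.2.1] at hrank
  -- Here `R i - t` and `S j - 1` are truncated. Removing from `E` the rows with sum below `t`, and
  -- from `F` the zero columns, makes the subtractions exact and does not increase `|E| |F|`.
  set E' := E.filter fun i => t ≤ R i with hE'
  set F' := F.filter fun j => 1 ≤ S j with hF'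
  have hcE : E'.card ≤ m := by simpa using Finset.card_le_univ E'
  have hcF : F'.card ≤ n := by simpa using Finset.card_le_univ F'
  have hsumE : ∑ i ∈ E, (R i - t) + t * E'.card = ∑ i ∈ E', R i := by
    rw [hE', mul_comm, ← smul_eq_mul, ← Finset.sum_const, Finset.sum_filter, Finset.sum_filter,
      ← Finset.sum_add_distrib]
    refine Finset.sum_congr rfl fun i _ => ?_
    split_ifs <;> omega
  have hsumF : ∑ j ∈ F, (S j - 1) + F'.card = ∑ j ∈ F', S j := by
    rw [hF', Finset.card_filter, Finset.sum_filter, ← Finset.sum_add_distrib]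
    refine Finset.sum_congr rfl fun j _ => ?_
    split_ifs <;> omega
  have hprod : E'.card * F'.card ≤ E.card * F.card :=
    Nat.mul_le_mul (Finset.card_filter_le _ _) (Finset.card_filter_le _ _)
  have hE1 := sum_le_sum_initial hR E'
  have hF1 := sum_le_sum_initial hS F'
  have hsplit : ∑ i, R i = ∑ i ∈ Finset.univ.filter (fun i : Fin m => i.val < E'.card), R i
      + ∑ i ∈ Finset.univ.filter (fun i : Fin m => E'.card ≤ i.val), R i := by
    rw [← Finset.sum_filter_add_sum_filter_not Finset.univ (fun i : Fin m => i.val < E'.card)]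
    simp only [not_lt]
  refine ⟨A, hA, ⟨E'.card, by omega⟩, ⟨F'.card, by omega⟩, ?_⟩
  simp only [structureMatrix]
  zify at *
  linarith

theorem theorem4p2 {m n : ℕ} (t : ℕ) (ht : 1 ≤ t)
    (R : Fin m → ℕ) (S : Fin n → ℕ) (hR : Antitone R) (hS : Antitone S)
    (hne : (matrixClass R S).Nonempty) :
    IsGreatest (tTermRank t '' matrixClass R S) (maxTTermRank t R S) ∧
    IsLeast
      (Set.range fun p : Fin (m + 1) × Fin (n + 1) =>
        structureMatrix R S p.1 p.2 + (t : ℤ) * (p.1.val : ℤ) + (p.2.val : ℤ))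
      (maxTTermRank t R S : ℤ) := by
  have hbdd : BddAbove (tTermRank t '' matrixClass R S) := by
    refine ⟨Fintype.card (Fin m × Fin n), ?_⟩
    rintro _ ⟨A, -, rfl⟩
    exact Finset.sup_le fun P _ => Finset.card_le_univ P
  have hmem : maxTTermRank t R S ∈ tTermRank t '' matrixClass R S :=
    Nat.sSup_mem (hne.image _) hbdd
  have hlower : ∀ e f, (maxTTermRank t R S : ℤ) ≤
      structureMatrix R S e f + (t : ℤ) * (e.val : ℤ) + (f.val : ℤ) := by
    obtain ⟨A, hA, h⟩ := hmem
    rw [← h]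
    exact tTermRank_le hA
  refine ⟨⟨hmem, fun x hx => le_csSup hbdd hx⟩, ?_, ?_⟩
  · obtain ⟨A, hA, e, f, hef⟩ := exists_le_tTermRank t hR hS hne
    have h1 : tTermRank t A ≤ maxTTermRank t R S := le_csSup hbdd ⟨A, hA, rfl⟩
    exact ⟨(e, f), le_antisymm (hef.trans (by exact_mod_cast h1)) (hlower e f)⟩
  · rintro _ ⟨p, rfl⟩
    exact hlower p.1 p.2
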